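/- Let $n\ge 2$, let $y_1,\dots,y_n\in\mathbb{R}^d$ be data, and let $\hat A\in\mathbb{R}^{d\times d}$ be a least-squares estimate of the VAR(1) transition matrix, i.e. a minimizer of $\sum_{i=1}^{n-1}\|y_{i+1}-By_i\|^2$ over $B\in\mathbb{R}^{d\times d}$ ($\|\cdot\|$ is the Euclidean norm). Let $\mathcal{D}\subseteq\mathbb{R}^m$ be convex, let $\Xi\subset\mathbb{R}^d$ be nonempty, convex, closed and bounded, and let $h:\mathcal{D}\times\mathbb{R}^d\to\mathbb{R}$, $(x,y)\mapsto h(x,y)$, be differentiable, convex in $x\in\mathcal D$ and concave in $y\in\mathbb{R}^d$. Let $\varepsilon_1\ge 0$, $\varepsilon_{2,1},\dots,\varepsilon_{2,d}\ge 0$, and let $\Omega$ be the set of $A\in\mathbb{R}^{d\times d}$ with $\|A_j-\hat A_j\|\le\varepsilon_{2,j}$ for all $j\in\{1,\dots,d\}$, where $A_j$, $\hat A_j$ denote the $j$-th columns. For $A\in\mathbb{R}^{d\times d}$ let $F_n^A=\frac1{n-1}\sum_{i=1}^{n-1}\delta_{y_{i+1}-Ay_i}$, and let $d_w$ be the 2-Wasserstein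 distance on $\mathbb{R}^d$. A maximum over an empty set is $-\infty$. Consider the three problems (DRO) $\displaystyle\ \inf_{x\in\mathcal{D}}\ \max_{A,F}\ \mathbb{E}_{\xi\sim F}\,h(x,Ay_n+\xi)$ over all $A\in\Omega$ and all Borel probability measures $F$ on $\mathbb{R}^d$ with $F(\Xi)=1$ and $d_w^2(F,F_n^A)\le\varepsilon_1$; (DRSO) $\displaystyle\ \inf_{x\in\mathcal{D}}\ \max_{A\in\Omega}\ \inf_{u\ge0}\ \max_{\xi_1,\dots,\xi_{n-1}\in\Xi}\ u\varepsilon_1+\frac1{n-1}\sum_{i=1}^{n-1}\Big[h(x,Ay_n+\xi_i)-u\,\|\xi_i-(y_{i+1}-Ay_i)\|^2\Big]$; (MM) $\displaystyle\ \inf_{x\in\mathcal{D}}\ \max_{A,\xi_1,\dots,\xi_{n-1}}\ \frac1{n-1}\sum_{i=1}^{n-1}h(x,Ay_n+\xi_i)$ over all $A\in\Omega$ and $\xi_1,\dots,\xi_{n-1}\in\Xi$ with $\displaystyle\frac1{n-1}\sum_{i=1}^{n-1}\|\xi_i-(y_{i+1}-Ay_i)\|^2\le\varepsilon_1$. Then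 (DRO) and (DRSO) are equivalent to (MM): for every $x\in\mathcal{D}$ the inner values of the three problems (everything after $\inf_{x\in\mathcal D}$) are equal, so that the three problems have the same optimal value and the same set of optimal decisions $x$. All expectations in (DRO) exist, and all maxima are attained (those in (DRO) and (MM) over $(A,F)$ and $(A,\xi_1,\dots,\xi_{n-1})$ whenever their constraint set is nonempty). Moreover (MM) is a finite-dimensional convex-concave problem: the feasible set of $(A,\xi_1,\dots,\xi_{n-1})$ is convex, compact and independent of $x$, and the objective is convex in $x\in\mathcal{D}$ and jointly concave in $(A,\xi_1,\dots,\xi_{n-1})$ on that set. -/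

import Mathlib

open MeasureTheory Set
open scoped ENNReal

noncomputable section

namespace VARDRSO

/-- `ℝᵏ` with its Euclidean norm (and Borel σ-algebra). -/
abbrev Vec (k : ℕ) : Type := EuclideanSpace ℝ (Fin k)

/-! ### The 2-Wasserstein distance -/

/-- `Π(P, Q)`: the measures on `X × X` with marginals `P` and `Q`. -/
def couplings {X : Type*} [MeasurableSpace X] (P Q : Measure X) : Set (Measure (X × X)) :=
  {π | π.fst = P ∧ π.snd = Q}

/-- The 2-Wasserstein distance
`d_w(P, Q) = inf_{π ∈ Π(P, Q)} √(∫ d(x, x')² π(dx, dx'))`, with values in `[0, ∞]`. -/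
def wasserstein {X : Type*} [MeasurableSpace X] [PseudoEMetricSpace X] (P Q : Measure X) : ℝ≥0∞ :=
  ⨅ π ∈ couplings P Q, (∫⁻ p, edist p.1 p.2 ^ 2 ∂π) ^ (1 / 2 : ℝ)

/-- The empirical distribution `(1/N) ∑ᵢ δ_{rᵢ}`. -/
def empirical {X : Type*} [MeasurableSpace X] {N : ℕ} (r : Fin N → X) : Measure X :=
  (N : ℝ≥0∞)⁻¹ • ∑ i, Measure.dirac (r i)

/-! ### VAR(1) data

With `N = n - 1`, the data `y₁, …, yₙ ∈ ℝᵈ` is a map `y : Fin (N + 1) → Vec d`. The pairs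
`(yᵢ, yᵢ₊₁)`, `i ∈ [n - 1]`, are `(y i.castSucc, y i.succ)` for `i : Fin N`, and `yₙ` is
`y (Fin.last N)`. -/

variable {m d N : ℕ}

/-- `Y₊ = [y₂, …, yₙ]`. -/
def Yplus (y : Fin (N + 1) → Vec d) : Matrix (Fin d) (Fin N) ℝ := Matrix.of fun k i => y i.succ k

/-- `Y₋ = [y₁, …, yₙ₋₁]`. -/
def Yminus (y : Fin (N + 1) → Vec d) : Matrix (Fin d) (Fin N) ℝ :=
  Matrix.of fun k i => y i.castSucc k

/-- The squared Frobenius norm. -/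
def frobeniusSq {p q : ℕ} (M : Matrix (Fin p) (Fin q) ℝ) : ℝ := ∑ k, ∑ i, M k i ^ 2

/-- `Â` is a least-squares estimate: it minimizes `‖Y₊ - B Y₋‖_F²` over all matrices `B`. -/
def IsLeastSquares (y : Fin (N + 1) → Vec d) (Ahat : Matrix (Fin d) (Fin d) ℝ) : Prop :=
  IsMinOn (fun B => frobeniusSq (Yplus y - B * Yminus y)) univ Ahat

/-- The residual `yᵢ₊₁ - A yᵢ`. -/
def residual (y : Fin (N + 1) → Vec d) (A : Matrix (Fin d) (Fin d) ℝ) (i : Fin N) : Vec d :=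
  y i.succ - Matrix.toEuclideanLin A (y i.castSucc)

/-- The `j`-th column of `A`, as a Euclidean vector. -/
def column (A : Matrix (Fin d) (Fin d) ℝ) (j : Fin d) : Vec d := WithLp.toLp 2 fun k => A k j

/-- The uncertainty set `Ω = {A | ‖A_j - Â_j‖ ≤ ε_{2,j} for all j}`. -/
def Omega (Ahat : Matrix (Fin d) (Fin d) ℝ) (ε₂ : Fin d → ℝ) : Set (Matrix (Fin d) (Fin d) ℝ) :=
  {A | ∀ j, ‖column A j - column Ahat j‖ ≤ ε₂ j}

/-! ### The distributionally robust problem -/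

/-- The pairs `(A, F)` with `A ∈ Ω`, `F` a probability distribution with `F(Ξ) = 1`, and
`d_w(F, Fₙ)² ≤ ε₁`, where `Fₙ` is the empirical distribution of the residuals of `A`. -/
def droFeasible (y : Fin (N + 1) → Vec d) (Ahat : Matrix (Fin d) (Fin d) ℝ) (Ξ : Set (Vec d))
    (ε₁ : ℝ) (ε₂ : Fin d → ℝ) : Set (Matrix (Fin d) (Fin d) ℝ × Measure (Vec d)) :=
  {p | p.1 ∈ Omega Ahat ε₂ ∧ IsProbabilityMeasure p.2 ∧ p.2 Ξ = 1 ∧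
    wasserstein p.2 (empirical (residual y p.1)) ^ 2 ≤ ENNReal.ofReal ε₁}

/-- `E_{ξ ∼ F} h(x, A yₙ + ξ)`. -/
def droObjective (h : Vec m → Vec d → ℝ) (y : Fin (N + 1) → Vec d) (x : Vec m)
    (p : Matrix (Fin d) (Fin d) ℝ × Measure (Vec d)) : ℝ :=
  ∫ ξ, h x (Matrix.toEuclideanLin p.1 (y (Fin.last N)) + ξ) ∂p.2

/-- The inner maximum `max_{A, F} E_{ξ ∼ F} h(x, A yₙ + ξ)`; it is `-∞` if no `(A, F)` is
feasible. -/
def droInner (h : Vec m → Vec d → ℝ) (y : Fin (N + 1) → Vec d) (Ahat : Matrix (Fin d) (Fin d) ℝ)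
    (Ξ : Set (Vec d)) (ε₁ : ℝ) (ε₂ : Fin d → ℝ) (x : Vec m) : EReal :=
  ⨆ p ∈ droFeasible y Ahat Ξ ε₁ ε₂, (droObjective h y x p : EReal)

/-! ### The Lagrangian problem -/

/-- The noise tuples `(ξ₁, …, ξₙ₋₁)` with all `ξᵢ ∈ Ξ`. -/
def noiseTuples (N : ℕ) (Ξ : Set (Vec d)) : Set (Fin N → Vec d) := {ξ | ∀ i, ξ i ∈ Ξ}

/-- `u ε₁ + (1/(n-1)) ∑ᵢ [h(x, A yₙ + ξᵢ) - u ‖ξᵢ - (yᵢ₊₁ - A yᵢ)‖²]`. -/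
def lagrangian (h : Vec m → Vec d → ℝ) (y : Fin (N + 1) → Vec d) (ε₁ : ℝ) (x : Vec m)
    (A : Matrix (Fin d) (Fin d) ℝ) (u : ℝ) (ξ : Fin N → Vec d) : ℝ :=
  u * ε₁ + (1 / (N : ℝ)) * ∑ i, (h x (Matrix.toEuclideanLin A (y (Fin.last N)) + ξ i)
    - u * ‖ξ i - residual y A i‖ ^ 2)

/-- `inf_{u ≥ 0} max_{ξᵢ ∈ Ξ}` of the Lagrangian, for fixed `x` and `A`. -/
def lagrangianValue (h : Vec m → Vec d → ℝ) (y : Fin (N + 1) → Vec d) (Ξ : Set (Vec d)) (ε₁ : ℝ)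
    (x : Vec m) (A : Matrix (Fin d) (Fin d) ℝ) : EReal :=
  ⨅ u ∈ Ici (0 : ℝ), ⨆ ξ ∈ noiseTuples N Ξ, (lagrangian h y ε₁ x A u ξ : EReal)

/-- `max_{A ∈ Ω} inf_{u ≥ 0} max_{ξᵢ ∈ Ξ}` of the Lagrangian, for fixed `x`. -/
def drsoInner (h : Vec m → Vec d → ℝ) (y : Fin (N + 1) → Vec d)
    (Ahat : Matrix (Fin d) (Fin d) ℝ) (Ξ : Set (Vec d)) (ε₁ : ℝ) (ε₂ : Fin d → ℝ) (x : Vec m) :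
    EReal :=
  ⨆ A ∈ Omega Ahat ε₂, lagrangianValue h y Ξ ε₁ x A

/-! ### The finite-dimensional minimax problem -/

/-- The pairs `(A, (ξ₁, …, ξₙ₋₁))` with `ξᵢ ∈ Ξ`,
`(1/(n-1)) ∑ᵢ ‖ξᵢ - (yᵢ₊₁ - A yᵢ)‖² ≤ ε₁` and `‖A_j - Â_j‖ ≤ ε_{2,j}` for all `j`. -/
def minimaxFeasible (y : Fin (N + 1) → Vec d) (Ahat : Matrix (Fin d) (Fin d) ℝ) (Ξ : Set (Vec d))
    (ε₁ : ℝ) (ε₂ : Fin d → ℝ) : Set (Matrix (Fin d) (Fin d) ℝ × (Fin N → Vec d)) :=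
  {p | p.2 ∈ noiseTuples N Ξ ∧
    (1 / (N : ℝ)) * ∑ i, ‖p.2 i - residual y p.1 i‖ ^ 2 ≤ ε₁ ∧
    ∀ j, ‖column p.1 j - column Ahat j‖ ≤ ε₂ j}

/-- `(1/(n-1)) ∑ᵢ h(x, A yₙ + ξᵢ)`. -/
def minimaxObjective (h : Vec m → Vec d → ℝ) (y : Fin (N + 1) → Vec d) (x : Vec m)
    (p : Matrix (Fin d) (Fin d) ℝ × (Fin N → Vec d)) : ℝ :=
  (1 / (N : ℝ)) * ∑ i, h x (Matrix.toEuclideanLin p.1 (y (Fin.last N)) + p.2 i)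

/-- The inner maximum of the finite-dimensional problem; it is `-∞` if nothing is feasible. -/
def minimaxInner (h : Vec m → Vec d → ℝ) (y : Fin (N + 1) → Vec d)
    (Ahat : Matrix (Fin d) (Fin d) ℝ) (Ξ : Set (Vec d)) (ε₁ : ℝ) (ε₂ : Fin d → ℝ) (x : Vec m) :
    EReal :=
  ⨆ p ∈ minimaxFeasible y Ahat Ξ ε₁ ε₂, (minimaxObjective h y x p : EReal)

/-! ### Minimization over `x ∈ 𝒟` -/

/-- The optimal value `inf_{x ∈ 𝒟} J(x)`. -/
def optimalValue (D : Set (Vec m)) (J : Vec m → EReal) : EReal := ⨅ x ∈ D, J x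

/-- The optimal decisions, i.e. the minimizers of `J` on `𝒟`. -/
def optimalDecisions (D : Set (Vec m)) (J : Vec m → EReal) : Set (Vec m) :=
  {x | x ∈ D ∧ IsMinOn J D x}

end VARDRSO

end

open VARDRSO

/-! Fix `x`. A coupling of `F` with the finitely supported residual distribution splits into fibers
over the atoms. Replacing the `F`-coordinate on each fiber by its mean cannot raise the convex
quadratic cost nor lower the expectation of the concave `h x`, and the means stay in `Ξ`
(`sum_fiberMean_le_integral`, `fiberMean_mem`). So some tuple dominates `F` within the same budget
(`exists_noise_of_wasserstein_le`). Conversely, a feasible tuple yields its empirical distribution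
with the same objective, so (DRO) equals (MM).

For fixed `A`, (DRSO) contains the Lagrangian dual of the maximization over tuples. Sion's theorem,
with compactness on the tuple side, closes the duality gap (`iInf_iSup_lagrangian_eq`). Values lie
in `EReal`, where infeasibility reads `⊥`, so no Slater point is needed.

Since `ξᵢ - (yᵢ₊₁ - A yᵢ)` is affine in `(A, ξ)`, (MM) is jointly concave over a convex set.
Compactness of that set gives the maximizers, which carry over to the other two problems. -/

theorem Continuous.integrable_comp_of_ae_mem_compact {α X E : Type*} [MeasurableSpace α]
    [TopologicalSpace X] [MeasurableSpace X] [OpensMeasurableSpace X]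
    [NormedAddCommGroup E] [SecondCountableTopology E] [MeasurableSpace E] [BorelSpace E]
    {μ : Measure α} [IsFiniteMeasure μ] {K : Set X} (hK : IsCompact K) {f : α → X}
    (hf : Measurable f) (hfK : ∀ᵐ a ∂μ, f a ∈ K) {g : X → E} (hg : Continuous g) :
    Integrable (fun a => g (f a)) μ := by
  obtain ⟨C, hC⟩ := hK.exists_bound_of_continuousOn hg.continuousOn
  exact Integrable.of_bound (hg.measurable.comp hf).aestronglyMeasurable C
    (hfK.mono fun a ha => hC _ ha)

/-! ### Empirical measures and conditional means over their atoms. -/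

section Coupling

variable {d N : ℕ}

/-- Points of the tuple may coincide, so the mass of an atom counts multiplicity. -/
theorem empirical_real_singleton (r : Fin N → Vec d) (c : Vec d) [DecidableEq (Vec d)] :
    (empirical r).real {c} = (N : ℝ)⁻¹ * (Finset.univ.filter fun i => r i = c).card := by
  simp only [measureReal_def, empirical, Measure.smul_apply, Measure.finsetSum_apply,
    Measure.dirac_apply, smul_eq_mul, ENNReal.toReal_mul, ENNReal.toReal_inv,
    ENNReal.toReal_natCast, Set.indicator_apply, mem_singleton_iff, Pi.one_apply]
  congr 1
  rw [Finset.sum_boole]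
  simp

theorem empirical_ae_mem_range (r : Fin N → Vec d) : ∀ᵐ v ∂(empirical r), v ∈ range r := by
  change range r ∈ ae (empirical r)
  rw [mem_ae_iff, empirical, Measure.smul_apply, Measure.finsetSum_apply,
    Finset.sum_eq_zero, smul_zero]
  intro i _
  rw [Measure.dirac_apply' _ (Set.finite_range r).measurableSet.compl]
  simp

theorem isProbabilityMeasure_empirical (hN : 0 < N) (r : Fin N → Vec d) :
    IsProbabilityMeasure (empirical r) := by
  constructor
  simp only [empirical, Measure.smul_apply, Measure.finsetSum_apply, measure_univ, smul_eq_mul,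
    Finset.sum_const, Finset.card_univ, Fintype.card_fin, nsmul_eq_mul, mul_one]
  exact ENNReal.inv_mul_cancel (by simp [hN.ne']) (by simp)

theorem integral_empirical (r : Fin N → Vec d) (g : Vec d → ℝ) :
    ∫ v, g v ∂(empirical r) = (1 / (N : ℝ)) * ∑ i, g (r i) := by
  rw [empirical, integral_smul_measure, integral_finsetSum_measure]
  · simp
  · intro i _
    exact integrable_dirac (by simp)

/-- The mean of the first coordinate conditional on the second coordinate being `c`. -/
noncomputable def fiberMean (π : Measure (Vec d × Vec d)) (c : Vec d) : Vec d :=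
  ⨍ p in Prod.snd ⁻¹' {c}, p.1 ∂π

/-- Jensen's inequality on the fibers of the second coordinate. -/
theorem sum_fiberMean_le_integral (r : Fin N → Vec d)
    (π : Measure (Vec d × Vec d)) [IsProbabilityMeasure π] (hsnd : π.snd = empirical r)
    {Ξ : Set (Vec d)} (hΞ : IsCompact Ξ) (hfst : ∀ᵐ p ∂π, p.1 ∈ Ξ)
    {φ : Vec d → Vec d → ℝ} (hφ : ∀ c, ConvexOn ℝ univ fun v => φ v c)
    (hφc : ∀ c, Continuous fun v => φ v c) :
    (1 / (N : ℝ)) * ∑ i, φ (fiberMean π (r i)) (r i) ≤ ∫ p, φ p.1 p.2 ∂π := by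
  classical
  have hmeas (c : Vec d) : MeasurableSet (Prod.snd ⁻¹' {c} : Set (Vec d × Vec d)) :=
    measurable_snd (measurableSet_singleton c)
  have hw (c : Vec d) : π.real (Prod.snd ⁻¹' {c}) =
      (N : ℝ)⁻¹ * (Finset.univ.filter fun i => r i = c).card := by
    rw [← empirical_real_singleton, ← hsnd, measureReal_def, measureReal_def,
      Measure.snd_apply (measurableSet_singleton c)]
  have hint (c : Vec d) : IntegrableOn (fun p => φ p.1 c) (Prod.snd ⁻¹' {c}) π :=
    ((hφc c).integrable_comp_of_ae_mem_compact hΞ measurable_fst hfst).integrableOn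
  have hcongr (c : Vec d) : EqOn (fun p : Vec d × Vec d => φ p.1 c) (fun p => φ p.1 p.2)
      (Prod.snd ⁻¹' {c}) := fun p hp => by
    have : p.2 = c := hp
    simp [this]
  -- The second marginal lives on the finite range of `r`, so finitely many fibers carry `π`; no
  -- disintegration is needed.
  have hcover : ∀ᵐ p ∂π, p ∈ ⋃ c ∈ Finset.univ.image r, (Prod.snd ⁻¹' {c} : Set (Vec d × Vec d)) := by
    have h1 : ∀ᵐ v ∂π.snd, v ∈ range r := hsnd ▸ empirical_ae_mem_range r
    filter_upwards [ae_of_ae_map measurable_snd.aemeasurable h1] with p hp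
    simpa [eq_comm] using hp
  have hsplit : ∫ p, φ p.1 p.2 ∂π =
      ∑ c ∈ Finset.univ.image r, ∫ p in Prod.snd ⁻¹' {c}, φ p.1 c ∂π := by
    rw [← Measure.restrict_eq_self_of_ae_mem hcover, integral_biUnion_finset]
    · rw [Measure.restrict_eq_self_of_ae_mem hcover]
      exact Finset.sum_congr rfl fun c _ => setIntegral_congr_fun (hmeas c) (hcongr c).symm
    · exact fun c _ => hmeas c
    · intro a _ b _ hab
      exact Disjoint.preimage _ (by simpa using hab)
    · intro c _
      exact (hint c).congr_fun (hcongr c) (hmeas c)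
  -- Grouping indices with equal `r i` gives each distinct atom the weight multiplicity over `N`,
  -- which is exactly the mass of its fiber.
  rw [hsplit, Finset.sum_comp (fun c => φ (fiberMean π c) c) r, Finset.mul_sum]
  refine Finset.sum_le_sum fun c hc => ?_
  obtain ⟨i, -, rfl⟩ := Finset.mem_image.1 hc
  have hNpos : 0 < N := i.pos
  have hpos : 0 < π.real (Prod.snd ⁻¹' {r i}) := by
    rw [hw]
    have : 0 < (Finset.univ.filter fun j => r j = r i).card :=
      Finset.card_pos.2 ⟨i, by simp⟩
    positivity
  have hne : π (Prod.snd ⁻¹' {r i}) ≠ 0 := fun h0 => by simp [measureReal_def, h0] at hpos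
  have hj := (hφ (r i)).map_set_average_le (μ := π) (t := Prod.snd ⁻¹' {r i})
    (f := fun p : Vec d × Vec d => p.1) (hφc (r i)).continuousOn isClosed_univ hne
    (measure_ne_top _ _) (by simp)
    ((continuous_id.integrable_comp_of_ae_mem_compact hΞ measurable_fst hfst).integrableOn)
    (hint (r i))
  rw [setAverage_eq π (fun p : Vec d × Vec d => φ p.1 (r i)), smul_eq_mul, ← div_eq_inv_mul,
    le_div_iff₀ hpos, hw] at hj
  calc _ = φ (fiberMean π (r i)) (r i) * ((N : ℝ)⁻¹ * (Finset.univ.filter fun j => r j = r i).card) := by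
        rw [nsmul_eq_mul]; ring
    _ ≤ _ := hj

theorem fiberMean_mem (r : Fin N → Vec d)
    (π : Measure (Vec d × Vec d)) [IsProbabilityMeasure π] (hsnd : π.snd = empirical r)
    {Ξ : Set (Vec d)} (hΞ : IsCompact Ξ) (hconv : Convex ℝ Ξ) (hfst : ∀ᵐ p ∂π, p.1 ∈ Ξ)
    (i : Fin N) : fiberMean π (r i) ∈ Ξ := by
  classical
  have hNpos : 0 < N := i.pos
  refine hconv.set_average_mem hΞ.isClosed ?_ (measure_ne_top _ _) (ae_restrict_of_ae hfst)
    ((continuous_id.integrable_comp_of_ae_mem_compact hΞ measurable_fst hfst).integrableOn)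
  -- An average stays in a closed convex set only over a set of nonzero mass; here `r i` is an atom.
  have hpos : 0 < (empirical r).real {r i} := by
    rw [empirical_real_singleton]
    have : 0 < (Finset.univ.filter fun j => r j = r i).card :=
      Finset.card_pos.2 ⟨i, by simp⟩
    positivity
  rw [← hsnd, measureReal_def, Measure.snd_apply (measurableSet_singleton _)] at hpos
  exact fun h0 => by simp [h0] at hpos

/-! ### Wasserstein balls around empirical measures versus tuples of points. -/

theorem convexOn_norm_sub_sq {E : Type*} [NormedAddCommGroup E] [NormedSpace ℝ E] (c : E) :
    ConvexOn ℝ univ fun v : E => ‖v - c‖ ^ 2 := by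
  have h := (convexOn_univ_norm (E := E)).pow (fun _ _ => norm_nonneg _) 2
  simpa [sub_eq_add_neg, add_comm, Function.comp_def] using h.translate_right (-c)

/-- The strict inequality lets a near-optimal coupling stand in for an optimal one. -/
theorem exists_lintegral_edist_sq_lt_of_wasserstein_sq_lt {X : Type*} [MeasurableSpace X]
    [PseudoEMetricSpace X] {P Q : Measure X} {b : ℝ≥0∞} (hb : wasserstein P Q ^ 2 < b) :
    ∃ π ∈ couplings P Q, ∫⁻ p, edist p.1 p.2 ^ 2 ∂π < b := by
  have h1 : wasserstein P Q < b ^ (1 / 2 : ℝ) := by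
    rw [one_div, ENNReal.lt_rpow_inv_iff (by norm_num)]
    exact_mod_cast hb
  simp only [wasserstein, iInf_lt_iff] at h1
  obtain ⟨π, hπ, h⟩ := h1
  exact ⟨π, hπ, (ENNReal.rpow_lt_rpow_iff (by norm_num)).1 h⟩

theorem wasserstein_sq_le {X : Type*} [MeasurableSpace X]
    [PseudoEMetricSpace X] {P Q : Measure X} {π : Measure (X × X)} (hπ : π ∈ couplings P Q) :
    wasserstein P Q ^ 2 ≤ ∫⁻ p, edist p.1 p.2 ^ 2 ∂π := by
  have h1 : wasserstein P Q ≤ (∫⁻ p, edist p.1 p.2 ^ 2 ∂π) ^ (1 / 2 : ℝ) := iInf₂_le π hπ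
  rw [one_div, ENNReal.le_rpow_inv_iff (by norm_num)] at h1
  exact_mod_cast h1

theorem isCompact_noiseTuples {Ξ : Set (Vec d)} (hΞ : IsCompact Ξ) :
    IsCompact (noiseTuples N Ξ) := by
  have : noiseTuples N Ξ = Set.univ.pi fun _ => Ξ := by
    ext ξ
    simp [noiseTuples]
  rw [this]
  exact isCompact_univ_pi fun _ => hΞ

theorem convex_noiseTuples {Ξ : Set (Vec d)} (hΞ : Convex ℝ Ξ) :
    Convex ℝ (noiseTuples N Ξ) :=
  fun _ hξ _ hζ _ _ ha hb hab i => hΞ (hξ i) (hζ i) ha hb hab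

/-- A distribution in the Wasserstein ball around an empirical distribution is dominated, for the
expectation of a concave function, by a tuple of points in the corresponding averaged ball. -/
theorem exists_noise_of_wasserstein_le (r : Fin N → Vec d) {Ξ : Set (Vec d)} (hΞ : IsCompact Ξ)
    (hconv : Convex ℝ Ξ) (F : Measure (Vec d)) [IsProbabilityMeasure F] (hF : F Ξ = 1)
    {ε : ℝ} (hε : 0 ≤ ε) (hw : wasserstein F (empirical r) ^ 2 ≤ ENNReal.ofReal ε)
    {g : Vec d → ℝ} (hg : ConcaveOn ℝ univ g) (hgc : Continuous g) :
    ∃ ξ ∈ noiseTuples N Ξ, (1 / (N : ℝ)) * ∑ i, ‖ξ i - r i‖ ^ 2 ≤ ε ∧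
      ∫ v, g v ∂F ≤ (1 / (N : ℝ)) * ∑ i, g (ξ i) := by
  have hFΞ : ∀ᵐ v ∂F, v ∈ Ξ := by
    rwa [← prob_compl_eq_zero_iff hΞ.measurableSet] at hF
  -- The slack `δ` pays for using a coupling that is only near-optimal.
  have key (δ : ℝ) (hδ : 0 < δ) : ∃ ξ ∈ noiseTuples N Ξ,
      (1 / (N : ℝ)) * ∑ i, ‖ξ i - r i‖ ^ 2 ≤ ε + δ ∧
        ∫ v, g v ∂F ≤ (1 / (N : ℝ)) * ∑ i, g (ξ i) := by
    obtain ⟨π, ⟨hfst, hsnd⟩, hcost⟩ := exists_lintegral_edist_sq_lt_of_wasserstein_sq_lt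
      (hw.trans_lt ((ENNReal.ofReal_lt_ofReal_iff (by linarith)).2 (lt_add_of_pos_right ε hδ)))
    have hprob : IsProbabilityMeasure π := ⟨by
      rw [← Measure.fst_univ, hfst, measure_univ]⟩
    have hmem : ∀ᵐ p ∂π, p.1 ∈ Ξ := by
      rw [← hfst] at hFΞ
      exact ae_of_ae_map measurable_fst.aemeasurable hFΞ
    refine ⟨fun i => fiberMean π (r i), fun i => fiberMean_mem r π hsnd hΞ hconv hmem i, ?_, ?_⟩
    · refine (sum_fiberMean_le_integral r π hsnd hΞ hmem (φ := fun v c => ‖v - c‖ ^ 2)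
        convexOn_norm_sub_sq (fun c => by fun_prop)).trans ?_
      rw [integral_eq_lintegral_of_nonneg_ae (Filter.Eventually.of_forall fun p => sq_nonneg _)
        (by fun_prop)]
      refine ENNReal.toReal_le_of_le_ofReal (by linarith) (le_of_eq_of_le ?_ hcost.le)
      refine lintegral_congr fun p => ?_
      rw [edist_dist, dist_eq_norm, ENNReal.ofReal_pow (norm_nonneg _)]
    · have h := sum_fiberMean_le_integral r π hsnd hΞ hmem (φ := fun v _ => -g v)
        (fun _ => hg.neg) (fun c => by fun_prop)
      rw [integral_neg, Finset.sum_neg_distrib, mul_neg, neg_le_neg_iff] at h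
      rw [← hfst, Measure.fst, integral_map measurable_fst.aemeasurable
        hgc.measurable.aestronglyMeasurable]
      exact h
  -- To remove `δ`, minimize the cost over the compact set of tuples that dominate `F`; the minimum
  -- is at most `ε + δ` for every `δ > 0`.
  have hS : IsCompact (noiseTuples N Ξ ∩
      {ξ | ∫ v, g v ∂F ≤ (1 / (N : ℝ)) * ∑ i, g (ξ i)}) :=
    (isCompact_noiseTuples hΞ).inter_right (isClosed_le (by fun_prop) (by fun_prop))
  obtain ⟨ξ₁, h₁, -, h₁'⟩ := key 1 one_pos
  obtain ⟨ξ, ⟨hξ, hξ'⟩, hmin⟩ := hS.exists_isMinOn ⟨ξ₁, h₁, h₁'⟩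
    (f := fun ξ => (1 / (N : ℝ)) * ∑ i, ‖ξ i - r i‖ ^ 2) (by fun_prop)
  refine ⟨ξ, hξ, le_of_forall_pos_le_add fun δ hδ => ?_, hξ'⟩
  obtain ⟨ζ, hζ, hc, ho⟩ := key δ hδ
  exact (hmin ⟨hζ, ho⟩).trans hc

/-- Matching points by index is a coupling, not necessarily optimal, hence only an upper bound. -/
theorem wasserstein_empirical_sq_le (ξ r : Fin N → Vec d) (hN : 0 < N) :
    wasserstein (empirical ξ) (empirical r) ^ 2 ≤
      ENNReal.ofReal ((1 / (N : ℝ)) * ∑ i, ‖ξ i - r i‖ ^ 2) := by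
  have hmem : (N : ℝ≥0∞)⁻¹ • ∑ i, Measure.dirac (ξ i, r i) ∈
      couplings (empirical ξ) (empirical r) := by
    constructor
    · ext s hs
      rw [Measure.fst_apply hs]
      simp [empirical, Measure.dirac_apply' _ hs, Measure.dirac_apply' _ (measurable_fst hs)]
      rfl
    · ext s hs
      rw [Measure.snd_apply hs]
      simp [empirical, Measure.dirac_apply' _ hs, Measure.dirac_apply' _ (measurable_snd hs)]
      rfl
  refine (wasserstein_sq_le hmem).trans (le_of_eq ?_)
  rw [lintegral_smul_measure, lintegral_finsetSum_measure, smul_eq_mul,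
    ENNReal.ofReal_mul (by positivity), ENNReal.ofReal_sum_of_nonneg fun i _ => sq_nonneg _,
    one_div, ENNReal.ofReal_inv_of_pos (by positivity), ENNReal.ofReal_natCast]
  congr 1
  refine Finset.sum_congr rfl fun i _ => ?_
  rw [lintegral_dirac, edist_dist, dist_eq_norm, ENNReal.ofReal_pow (norm_nonneg _)]

end Coupling

/-! ### Lagrangian duality through Sion's theorem. -/

/-- The infimum over the multiplier of a Lagrangian with value `a` and slack `b`. -/
theorem iInf_Ici_add_mul (a b : ℝ) :
    ⨅ u ∈ Ici (0 : ℝ), ((a + u * b : ℝ) : EReal) = if 0 ≤ b then (a : EReal) else ⊥ := by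
  split_ifs with hb
  · refine le_antisymm ((iInf₂_le 0 self_mem_Ici).trans (by simp)) (le_iInf₂ fun u hu => ?_)
    exact EReal.coe_le_coe_iff.2 (le_add_of_nonneg_right (mul_nonneg hu hb))
  · push Not at hb
    refine eq_bot_iff.2 (le_of_forall_gt fun c hc => ?_)
    obtain ⟨s, -, hs⟩ := EReal.lt_iff_exists_real_btwn.1 hc
    -- The line `a + u * b` reaches height `s` at `u = (a - s) / -b`; beyond that it is lower, since
    -- `b < 0`.
    refine (iInf₂_le (max 0 ((a - s) / -b)) (le_max_left _ _)).trans_lt (lt_of_le_of_lt ?_ hs)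
    refine EReal.coe_le_coe_iff.2 ?_
    have h1 : (a - s) / -b * -b = a - s := div_mul_cancel₀ _ (by linarith)
    have h2 := mul_le_mul_of_nonneg_right (le_max_right 0 ((a - s) / -b)) (by linarith : 0 ≤ -b)
    linarith

/-- Lagrangian duality for a concave program with one concave constraint on a compact set; no
constraint qualification is needed. -/
theorem iInf_iSup_lagrangian_eq {E : Type*} [TopologicalSpace E] [AddCommGroup E] [Module ℝ E]
    [IsTopologicalAddGroup E] [ContinuousSMul ℝ E] {K : Set E} (hK : IsCompact K)
    (hKne : K.Nonempty) {f g : E → ℝ} (hf : ConcaveOn ℝ K f) (hg : ConcaveOn ℝ K g)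
    (hfc : ContinuousOn f K) (hgc : ContinuousOn g K) :
    ⨅ u ∈ Ici (0 : ℝ), ⨆ ξ ∈ K, ((f ξ + u * g ξ : ℝ) : EReal) =
      ⨆ ξ ∈ {ξ | ξ ∈ K ∧ 0 ≤ g ξ}, (f ξ : EReal) := by
  have hmono : Monotone (Real.toEReal) := EReal.coe_strictMono.monotone
  have sion : ⨆ ξ ∈ K, ⨅ u ∈ Ici (0 : ℝ), ((f ξ + u * g ξ : ℝ) : EReal) =
      ⨅ u ∈ Ici (0 : ℝ), ⨆ ξ ∈ K, ((f ξ + u * g ξ : ℝ) : EReal) := by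
    -- The order is reversed because the compact variable, here `ξ`, must be the one minimized over.
    refine Sion.minimax' (β := ERealᵒᵈ) (X := K) (Y := Ici (0 : ℝ))
      (f := fun ξ u => OrderDual.toDual ((f ξ + u * g ξ : ℝ) : EReal)) hKne hf.1 hK ?_ ?_
      (convex_Ici 0) ?_ ?_
    · intro u _
      have : UpperSemicontinuousOn (fun ξ => ((f ξ + u * g ξ : ℝ) : EReal)) K :=
        (continuous_coe_real_ereal.comp_continuousOn
          (hfc.add (continuousOn_const.mul hgc))).upperSemicontinuousOn
      exact this
    · intro u hu
      exact (((hf.add (hg.smul hu)).quasiconcaveOn).monotone_comp hmono).dual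
    · intro ξ _
      have : LowerSemicontinuousOn (fun u : ℝ => ((f ξ + u * g ξ : ℝ) : EReal)) (Ici 0) :=
        (continuous_coe_real_ereal.comp (by fun_prop)).continuousOn.lowerSemicontinuousOn
      exact this
    · intro ξ _
      have hc : ConvexOn ℝ (Ici (0 : ℝ)) fun u => f ξ + u * g ξ := by
        refine ⟨convex_Ici 0, fun u _ v _ a b _ _ hab => le_of_eq ?_⟩
        simp only [smul_eq_mul]
        linear_combination -(f ξ) * hab
      exact (hc.quasiconvexOn.monotone_comp hmono).dual
  rw [← sion]
  simp_rw [iInf_Ici_add_mul]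
  refine le_antisymm (iSup₂_le fun ξ hξ => ?_) (iSup₂_le fun ξ hξ => ?_)
  · split_ifs with hb
    · exact le_iSup₂ (f := fun ξ _ => (f ξ : EReal)) ξ ⟨hξ, hb⟩
    · exact bot_le
  · refine le_trans ?_ (le_iSup₂ ξ hξ.1)
    rw [if_pos hξ.2]

/-! ### Joint convexity, continuity and compactness of the finite-dimensional problem. -/

section Minimax

variable {m d N : ℕ}

/-- Exhibits the deviation as a linear map of `(A, ξ)` minus fixed data, the source of joint
convexity of the cost. -/
theorem sub_residual (y : Fin (N + 1) → Vec d) (A : Matrix (Fin d) (Fin d) ℝ) (v : Vec d)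
    (i : Fin N) :
    v - VARDRSO.residual y A i = (Matrix.toEuclideanLin A (y i.castSucc) + v) - y i.succ := by
  rw [VARDRSO.residual]
  abel

/-- The linear map `(A, ξ) ↦ A v + ξᵢ`. -/
noncomputable def shiftedNoise (v : Vec d) (i : Fin N) :
    (Matrix (Fin d) (Fin d) ℝ × (Fin N → Vec d)) →ₗ[ℝ] Vec d :=
  ((LinearMap.applyₗ v).comp Matrix.toEuclideanLin.toLinearMap).comp (LinearMap.fst ℝ _ _) +
    (LinearMap.proj (R := ℝ) (φ := fun _ : Fin N => Vec d) i).comp (LinearMap.snd ℝ _ _)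

theorem convexOn_finsetSum {E ι : Type*} [AddCommGroup E] [Module ℝ E] {K : Set E}
    (hK : Convex ℝ K) (t : Finset ι) {f : ι → E → ℝ} (hf : ∀ i ∈ t, ConvexOn ℝ K (f i)) :
    ConvexOn ℝ K fun v => ∑ i ∈ t, f i v := by
  classical
  induction t using Finset.induction_on with
  | empty => simpa using convexOn_const (0 : ℝ) hK
  | insert a t ha ih =>
    simp only [Finset.sum_insert ha]
    exact (hf a (Finset.mem_insert_self a t)).add
      (ih fun i hi => hf i (Finset.mem_insert_of_mem hi))

theorem concaveOn_finsetSum {E ι : Type*} [AddCommGroup E] [Module ℝ E] {K : Set E}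
    (hK : Convex ℝ K) (t : Finset ι) {f : ι → E → ℝ} (hf : ∀ i ∈ t, ConcaveOn ℝ K (f i)) :
    ConcaveOn ℝ K fun v => ∑ i ∈ t, f i v := by
  have h := (convexOn_finsetSum hK t fun i hi => (hf i hi).neg).neg
  simpa [Pi.neg_def] using h

theorem shiftedNoise_apply (v : Vec d) (i : Fin N)
    (p : Matrix (Fin d) (Fin d) ℝ × (Fin N → Vec d)) :
    shiftedNoise v i p = Matrix.toEuclideanLin p.1 v + p.2 i := rfl

theorem continuous_toEuclideanLin_apply (v : Vec d) :
    Continuous fun A : Matrix (Fin d) (Fin d) ℝ => Matrix.toEuclideanLin A v := by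
  simp only [Matrix.toLpLin_apply]
  refine (PiLp.continuous_toLp 2 _).comp ?_
  exact continuous_id.matrix_mulVec continuous_const

theorem continuous_shiftedNoise (v : Vec d) (i : Fin N) :
    Continuous (shiftedNoise (N := N) v i) := by
  simp only [funext (shiftedNoise_apply v i)]
  exact ((continuous_toEuclideanLin_apply v).comp continuous_fst).add (by fun_prop)

theorem convexOn_sum_norm_sub_residual (y : Fin (N + 1) → Vec d) :
    ConvexOn ℝ univ fun p : Matrix (Fin d) (Fin d) ℝ × (Fin N → Vec d) =>
      (1 / (N : ℝ)) * ∑ i, ‖p.2 i - VARDRSO.residual y p.1 i‖ ^ 2 := by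
  have h : ConvexOn ℝ univ fun p : Matrix (Fin d) (Fin d) ℝ × (Fin N → Vec d) =>
      ∑ i, ‖p.2 i - VARDRSO.residual y p.1 i‖ ^ 2 := by
    refine convexOn_finsetSum convex_univ _ fun i _ => ?_
    simp only [sub_residual]
    exact (convexOn_norm_sub_sq (y i.succ)).comp_linearMap (shiftedNoise (y i.castSucc) i)
  exact h.smul (by positivity)

theorem continuous_sum_norm_sub_residual (y : Fin (N + 1) → Vec d) :
    Continuous fun p : Matrix (Fin d) (Fin d) ℝ × (Fin N → Vec d) =>
      (1 / (N : ℝ)) * ∑ i, ‖p.2 i - VARDRSO.residual y p.1 i‖ ^ 2 := by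
  simp only [sub_residual]
  have := fun i : Fin N => continuous_shiftedNoise (y i.castSucc) i
  simp only [funext (shiftedNoise_apply _ _)] at this
  fun_prop

theorem concaveOn_minimaxObjective {h : Vec m → Vec d → ℝ} (y : Fin (N + 1) → Vec d) {x : Vec m}
    (hx : ConcaveOn ℝ univ (h x)) : ConcaveOn ℝ univ (minimaxObjective h y x) := by
  have hs : ConcaveOn ℝ univ fun p : Matrix (Fin d) (Fin d) ℝ × (Fin N → Vec d) =>
      ∑ i, h x (Matrix.toEuclideanLin p.1 (y (Fin.last N)) + p.2 i) :=
    concaveOn_finsetSum convex_univ _ fun i _ => hx.comp_linearMap (shiftedNoise (y (Fin.last N)) i)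
  exact hs.smul (by positivity)

theorem continuous_minimaxObjective {h : Vec m → Vec d → ℝ} (y : Fin (N + 1) → Vec d) {x : Vec m}
    (hx : Continuous (h x)) : Continuous (minimaxObjective h y x) := by
  have (i : Fin N) : Continuous fun p : Matrix (Fin d) (Fin d) ℝ × (Fin N → Vec d) =>
      h x (Matrix.toEuclideanLin p.1 (y (Fin.last N)) + p.2 i) :=
    hx.comp (continuous_shiftedNoise (y (Fin.last N)) i)
  exact continuous_const.mul (continuous_finsetSum _ fun i _ => this i)

/-- Assembling columns into a matrix is continuous and maps a product of closed balls onto this set.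
-/
theorem isCompact_Omega (Ahat : Matrix (Fin d) (Fin d) ℝ) (ε₂ : Fin d → ℝ) :
    IsCompact (Omega Ahat ε₂) := by
  have hK : IsCompact (univ.pi fun j => Metric.closedBall (column Ahat j) (ε₂ j)) :=
    isCompact_univ_pi fun j => isCompact_closedBall _ _
  have hc : Continuous fun (c : Fin d → Vec d) => (Matrix.of fun k j => c j k) :=
    continuous_matrix fun k j => by simp only [Matrix.of_apply]; fun_prop
  convert hK.image hc using 1
  ext A
  constructor
  · intro hA
    refine ⟨fun j => column A j, fun j _ => ?_, ?_⟩
    · rw [mem_closedBall_iff_norm]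
      exact hA j
    · ext k j
      rfl
  · rintro ⟨c, hc, rfl⟩ j
    have := hc j (mem_univ j)
    rw [mem_closedBall_iff_norm] at this
    exact this

theorem convex_Omega (Ahat : Matrix (Fin d) (Fin d) ℝ) (ε₂ : Fin d → ℝ) :
    Convex ℝ (Omega Ahat ε₂) := by
  intro A hA B hB a b ha hb hab j
  have h := convex_closedBall (column Ahat j) (ε₂ j) (mem_closedBall_iff_norm.2 (hA j))
    (mem_closedBall_iff_norm.2 (hB j)) ha hb hab
  rw [mem_closedBall_iff_norm] at h
  exact h

theorem minimaxFeasible_eq (y : Fin (N + 1) → Vec d) (Ahat : Matrix (Fin d) (Fin d) ℝ)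
    (Ξ : Set (Vec d)) (ε₁ : ℝ) (ε₂ : Fin d → ℝ) :
    minimaxFeasible y Ahat Ξ ε₁ ε₂ = (Omega Ahat ε₂ ×ˢ noiseTuples N Ξ) ∩
      {p | (1 / (N : ℝ)) * ∑ i, ‖p.2 i - VARDRSO.residual y p.1 i‖ ^ 2 ≤ ε₁} := by
  ext p
  simp only [minimaxFeasible, Omega, mem_ofPred_eq, mem_inter_iff, mem_prod]
  tauto

theorem isCompact_minimaxFeasible (y : Fin (N + 1) → Vec d) (Ahat : Matrix (Fin d) (Fin d) ℝ)
    {Ξ : Set (Vec d)} (hΞ : IsCompact Ξ) (ε₁ : ℝ) (ε₂ : Fin d → ℝ) :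
    IsCompact (minimaxFeasible y Ahat Ξ ε₁ ε₂) := by
  rw [minimaxFeasible_eq]
  exact ((isCompact_Omega _ _).prod (isCompact_noiseTuples hΞ)).inter_right
    (isClosed_le (continuous_sum_norm_sub_residual y) continuous_const)

theorem convex_minimaxFeasible (y : Fin (N + 1) → Vec d) (Ahat : Matrix (Fin d) (Fin d) ℝ)
    {Ξ : Set (Vec d)} (hΞ : Convex ℝ Ξ) (ε₁ : ℝ) (ε₂ : Fin d → ℝ) :
    Convex ℝ (minimaxFeasible y Ahat Ξ ε₁ ε₂) := by
  rw [minimaxFeasible_eq]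
  refine ((convex_Omega _ _).prod (convex_noiseTuples hΞ)).inter ?_
  simpa using (convexOn_sum_norm_sub_residual y).convex_le ε₁

/-- For fixed `A`, the dual value is the maximum of the constrained problem over the noise. -/
theorem lagrangianValue_eq {h : Vec m → Vec d → ℝ} (y : Fin (N + 1) → Vec d) {Ξ : Set (Vec d)}
    (hΞ : IsCompact Ξ) (hΞne : Ξ.Nonempty) (hconv : Convex ℝ Ξ) (ε₁ : ℝ) {x : Vec m}
    (hx : ConcaveOn ℝ univ (h x)) (hxc : Continuous (h x)) (A : Matrix (Fin d) (Fin d) ℝ) :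
    lagrangianValue h y Ξ ε₁ x A =
      ⨆ ξ ∈ {ξ | ξ ∈ noiseTuples N Ξ ∧
        (1 / (N : ℝ)) * ∑ i, ‖ξ i - VARDRSO.residual y A i‖ ^ 2 ≤ ε₁},
        (minimaxObjective h y x (A, ξ) : EReal) := by
  -- The slice `ξ ↦ (A, ξ)` is affine, so the joint convexity statements restrict to it.
  let ι : (Fin N → Vec d) →ᵃ[ℝ] Matrix (Fin d) (Fin d) ℝ × (Fin N → Vec d) :=
    (AffineMap.const ℝ _ A).prod (AffineMap.id ℝ _)
  have hι : Continuous fun ξ : Fin N → Vec d => (A, ξ) := by fun_prop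
  have hK := convex_noiseTuples (N := N) hconv
  have hne : (noiseTuples N Ξ).Nonempty :=
    let ⟨v, hv⟩ := hΞne
    ⟨fun _ => v, fun _ => hv⟩
  have hf : ConcaveOn ℝ (noiseTuples N Ξ) fun ξ => minimaxObjective h y x (A, ξ) :=
    ((concaveOn_minimaxObjective y hx).comp_affineMap ι).subset (subset_univ _) hK
  have hg : ConcaveOn ℝ (noiseTuples N Ξ) fun ξ =>
      ε₁ - (1 / (N : ℝ)) * ∑ i, ‖ξ i - VARDRSO.residual y A i‖ ^ 2 :=
    (concaveOn_const ε₁ hK).sub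
      (((convexOn_sum_norm_sub_residual y).comp_affineMap ι).subset (subset_univ _) hK)
  have key := iInf_iSup_lagrangian_eq (isCompact_noiseTuples hΞ) hne hf hg
    ((continuous_minimaxObjective y hxc).comp hι).continuousOn
    (continuous_const.sub ((continuous_sum_norm_sub_residual y).comp hι)).continuousOn
  simp only [sub_nonneg] at key
  rw [← key, lagrangianValue]
  refine iInf_congr fun u => iInf_congr fun _ => iSup_congr fun ξ => iSup_congr fun _ => ?_
  congr 1
  simp only [lagrangian, minimaxObjective, Finset.sum_sub_distrib, ← Finset.mul_sum]
  ring

theorem continuous_lagrangian {h : Vec m → Vec d → ℝ} (y : Fin (N + 1) → Vec d) (ε₁ : ℝ)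
    {x : Vec m} (hxc : Continuous (h x)) (A : Matrix (Fin d) (Fin d) ℝ) (u : ℝ) :
    Continuous (lagrangian h y ε₁ x A u) := by
  unfold lagrangian
  fun_prop

end Minimax

/-! ### Passing between distributions and tuples. -/

section Equivalence

variable {m d N : ℕ}

/-- The matrix is kept and only the distribution is replaced. This serves both the equality of
values and attainment. -/
theorem exists_minimaxFeasible_of_droFeasible {h : Vec m → Vec d → ℝ} {y : Fin (N + 1) → Vec d}
    {Ahat : Matrix (Fin d) (Fin d) ℝ} {Ξ : Set (Vec d)} (hΞ : IsCompact Ξ) (hconv : Convex ℝ Ξ)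
    {ε₁ : ℝ} (hε₁ : 0 ≤ ε₁) {ε₂ : Fin d → ℝ} {x : Vec m} (hx : ConcaveOn ℝ univ (h x))
    (hxc : Continuous (h x)) {p : Matrix (Fin d) (Fin d) ℝ × Measure (Vec d)}
    (hp : p ∈ droFeasible y Ahat Ξ ε₁ ε₂) :
    ∃ q ∈ minimaxFeasible y Ahat Ξ ε₁ ε₂, droObjective h y x p ≤ minimaxObjective h y x q := by
  obtain ⟨hA, hprob, hF, hw⟩ := hp
  obtain ⟨ξ, hξ, hcost, hobj⟩ := exists_noise_of_wasserstein_le (VARDRSO.residual y p.1) hΞ hconv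
    p.2 hF hε₁ hw (g := fun v => h x (Matrix.toEuclideanLin p.1 (y (Fin.last N)) + v))
    (by simpa [Function.comp_def] using
      hx.translate_right (Matrix.toEuclideanLin p.1 (y (Fin.last N)))) (by fun_prop)
  exact ⟨(p.1, ξ), ⟨hξ, hcost, hA⟩, hobj⟩

theorem droFeasible_empirical {y : Fin (N + 1) → Vec d} (hN : 0 < N)
    {Ahat : Matrix (Fin d) (Fin d) ℝ} {Ξ : Set (Vec d)} (hΞ : MeasurableSet Ξ)
    {ε₁ : ℝ} {ε₂ : Fin d → ℝ} {q : Matrix (Fin d) (Fin d) ℝ × (Fin N → Vec d)}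
    (hq : q ∈ minimaxFeasible y Ahat Ξ ε₁ ε₂) :
    (q.1, empirical q.2) ∈ droFeasible y Ahat Ξ ε₁ ε₂ := by
  have hprob := isProbabilityMeasure_empirical hN q.2
  refine ⟨hq.2.2, hprob, ?_, ?_⟩
  · rw [← prob_compl_eq_zero_iff hΞ, ← mem_ae_iff]
    refine (empirical_ae_mem_range q.2).mono ?_
    rintro _ ⟨i, rfl⟩
    exact hq.1 i
  · exact (wasserstein_empirical_sq_le _ _ hN).trans (ENNReal.ofReal_le_ofReal hq.2.1)

theorem droObjective_empirical (h : Vec m → Vec d → ℝ) (y : Fin (N + 1) → Vec d) (x : Vec m)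
    (q : Matrix (Fin d) (Fin d) ℝ × (Fin N → Vec d)) :
    droObjective h y x (q.1, empirical q.2) = minimaxObjective h y x q :=
  integral_empirical _ _

theorem optimalDecisions_congr {D : Set (Vec m)} {J J' : Vec m → EReal} (hJ : EqOn J J' D) :
    optimalDecisions D J = optimalDecisions D J' := by
  ext x
  simp only [optimalDecisions, mem_ofPred_eq, isMinOn_iff]
  refine and_congr_right fun hx => forall₂_congr fun z hz => ?_
  rw [hJ hx, hJ hz]

end Equivalence

theorem theorem2 {m d N : ℕ} (hN : 0 < N)
    (y : Fin (N + 1) → Vec d) (Ahat : Matrix (Fin d) (Fin d) ℝ) (hAhat : IsLeastSquares y Ahat)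
    (D : Set (Vec m)) (hD : Convex ℝ D)
    (Ξ : Set (Vec d)) (hΞne : Ξ.Nonempty) (hΞconv : Convex ℝ Ξ) (hΞclosed : IsClosed Ξ)
    (hΞbdd : Bornology.IsBounded Ξ)
    (h : Vec m → Vec d → ℝ)
    (hdiff : DifferentiableOn ℝ (fun p : Vec m × Vec d => h p.1 p.2) (D ×ˢ univ))
    (hconvex : ∀ v, ConvexOn ℝ D fun x => h x v)
    (hconcave : ∀ x ∈ D, ConcaveOn ℝ univ (h x))
    (ε₁ : ℝ) (hε₁ : 0 ≤ ε₁) (ε₂ : Fin d → ℝ) (hε₂ : ∀ j, 0 ≤ ε₂ j) :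
    -- for every decision the three inner values agree
    (∀ x ∈ D,
      droInner h y Ahat Ξ ε₁ ε₂ x = minimaxInner h y Ahat Ξ ε₁ ε₂ x ∧
      drsoInner h y Ahat Ξ ε₁ ε₂ x = minimaxInner h y Ahat Ξ ε₁ ε₂ x) ∧
    -- the three problems have the same optimal value
    (optimalValue D (droInner h y Ahat Ξ ε₁ ε₂) = optimalValue D (minimaxInner h y Ahat Ξ ε₁ ε₂) ∧
      optimalValue D (drsoInner h y Ahat Ξ ε₁ ε₂) =
        optimalValue D (minimaxInner h y Ahat Ξ ε₁ ε₂)) ∧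
    -- and the same optimal decisions
    (optimalDecisions D (droInner h y Ahat Ξ ε₁ ε₂) =
        optimalDecisions D (minimaxInner h y Ahat Ξ ε₁ ε₂) ∧
      optimalDecisions D (drsoInner h y Ahat Ξ ε₁ ε₂) =
        optimalDecisions D (minimaxInner h y Ahat Ξ ε₁ ε₂)) ∧
    -- the expectations in the robust problem exist
    (∀ x ∈ D, ∀ p ∈ droFeasible y Ahat Ξ ε₁ ε₂,
      Integrable (fun ξ => h x (Matrix.toEuclideanLin p.1 (y (Fin.last N)) + ξ)) p.2) ∧
    -- all the maxima are attained (the constrained ones as soon as they are feasible)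
    (∀ x ∈ D,
      ((droFeasible y Ahat Ξ ε₁ ε₂).Nonempty → ∃ p ∈ droFeasible y Ahat Ξ ε₁ ε₂,
        IsMaxOn (droObjective h y x) (droFeasible y Ahat Ξ ε₁ ε₂) p) ∧
      (∃ A ∈ Omega Ahat ε₂, IsMaxOn (lagrangianValue h y Ξ ε₁ x) (Omega Ahat ε₂) A) ∧
      (∀ A ∈ Omega Ahat ε₂, ∀ u : ℝ, 0 ≤ u → ∃ ξ ∈ noiseTuples N Ξ,
        IsMaxOn (lagrangian h y ε₁ x A u) (noiseTuples N Ξ) ξ) ∧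
      ((minimaxFeasible y Ahat Ξ ε₁ ε₂).Nonempty → ∃ p ∈ minimaxFeasible y Ahat Ξ ε₁ ε₂,
        IsMaxOn (minimaxObjective h y x) (minimaxFeasible y Ahat Ξ ε₁ ε₂) p)) ∧
    -- the finite-dimensional problem is convex-concave: it is convex in `x ∈ D` and jointly
    -- concave in `(A, ξ₁, …, ξₙ₋₁)` over a convex compact set that does not depend on `x`
    (Convex ℝ (minimaxFeasible y Ahat Ξ ε₁ ε₂) ∧ IsCompact (minimaxFeasible y Ahat Ξ ε₁ ε₂) ∧
      (∀ p ∈ minimaxFeasible y Ahat Ξ ε₁ ε₂, ConvexOn ℝ D fun x => minimaxObjective h y x p) ∧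
      (∀ x ∈ D, ConcaveOn ℝ (minimaxFeasible y Ahat Ξ ε₁ ε₂) (minimaxObjective h y x))) := by
  have hΞ : IsCompact Ξ := Metric.isCompact_of_isClosed_isBounded hΞclosed hΞbdd
  -- Differentiability enters only through this continuity.
  have hcont (x : Vec m) (hx : x ∈ D) : Continuous (h x) := by
    have hc : ContinuousOn (fun v : Vec d => h x v) univ :=
      hdiff.continuousOn.comp (f := fun v : Vec d => (x, v)) (by fun_prop) fun v _ => ⟨hx, mem_univ v⟩
    exact continuousOn_univ.1 hc
  have hdro : EqOn (droInner h y Ahat Ξ ε₁ ε₂) (minimaxInner h y Ahat Ξ ε₁ ε₂) D := by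
    intro x hx
    refine le_antisymm (iSup₂_le fun p hp => ?_) (iSup₂_le fun q hq => ?_)
    · obtain ⟨q, hq, hpq⟩ := exists_minimaxFeasible_of_droFeasible hΞ hΞconv hε₁
        (hconcave x hx) (hcont x hx) hp
      exact (EReal.coe_le_coe_iff.2 hpq).trans
        (le_iSup₂ (f := fun q _ => (minimaxObjective h y x q : EReal)) q hq)
    · rw [← droObjective_empirical]
      exact le_iSup₂ (f := fun p _ => (droObjective h y x p : EReal)) _
        (droFeasible_empirical hN hΞclosed.measurableSet hq)
  have hval (x : Vec m) (hx : x ∈ D) (A : Matrix (Fin d) (Fin d) ℝ) :=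
    lagrangianValue_eq y hΞ hΞne hΞconv ε₁ (hconcave x hx) (hcont x hx) A
  have hdrso : EqOn (drsoInner h y Ahat Ξ ε₁ ε₂) (minimaxInner h y Ahat Ξ ε₁ ε₂) D := by
    intro x hx
    simp only [drsoInner, hval x hx]
    refine le_antisymm (iSup₂_le fun A hA => iSup₂_le fun ξ hξ => ?_) (iSup₂_le fun q hq => ?_)
    · exact le_iSup₂ (f := fun q _ => (minimaxObjective h y x q : EReal)) (A, ξ)
        ⟨hξ.1, hξ.2, hA⟩
    · exact le_iSup₂_of_le q.1 hq.2.2 (le_iSup₂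
        (f := fun ξ (_ : ξ ∈ {ξ | ξ ∈ noiseTuples N Ξ ∧
          (1 / (N : ℝ)) * ∑ i, ‖ξ i - VARDRSO.residual y q.1 i‖ ^ 2 ≤ ε₁}) =>
          (minimaxObjective h y x (q.1, ξ) : EReal)) q.2 ⟨hq.1, hq.2.1⟩)
  have hmax (x : Vec m) (hx : x ∈ D) (hne : (minimaxFeasible y Ahat Ξ ε₁ ε₂).Nonempty) :
      ∃ p ∈ minimaxFeasible y Ahat Ξ ε₁ ε₂,
        IsMaxOn (minimaxObjective h y x) (minimaxFeasible y Ahat Ξ ε₁ ε₂) p :=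
    (isCompact_minimaxFeasible y Ahat hΞ ε₁ ε₂).exists_isMaxOn hne
      (continuous_minimaxObjective y (hcont x hx)).continuousOn
  refine ⟨fun x hx => ⟨hdro hx, hdrso hx⟩,
    ⟨biInf_congr fun _ hx => hdro hx, biInf_congr fun _ hx => hdrso hx⟩,
    ⟨optimalDecisions_congr hdro, optimalDecisions_congr hdrso⟩, ?_, ?_,
    convex_minimaxFeasible y Ahat hΞconv ε₁ ε₂, isCompact_minimaxFeasible y Ahat hΞ ε₁ ε₂, ?_, ?_⟩
  · intro x hx p hp
    have := hp.2.1
    have hF := hp.2.2.1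
    rw [← prob_compl_eq_zero_iff hΞclosed.measurableSet] at hF
    have hxc := hcont x hx
    exact Continuous.integrable_comp_of_ae_mem_compact hΞ measurable_id hF
      (g := fun ξ => h x (Matrix.toEuclideanLin p.1 (y (Fin.last N)) + ξ)) (by fun_prop)
  · intro x hx
    refine ⟨?_, ?_, ?_, hmax x hx⟩
    · rintro ⟨p₀, hp₀⟩
      obtain ⟨q₀, hq₀, -⟩ := exists_minimaxFeasible_of_droFeasible hΞ hΞconv hε₁
        (hconcave x hx) (hcont x hx) hp₀
      obtain ⟨q, hq, hqmax⟩ := hmax x hx ⟨q₀, hq₀⟩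
      refine ⟨_, droFeasible_empirical hN hΞclosed.measurableSet hq, fun p hp => ?_⟩
      obtain ⟨q', hq', hpq'⟩ := exists_minimaxFeasible_of_droFeasible hΞ hΞconv hε₁
        (hconcave x hx) (hcont x hx) hp
      rw [mem_ofPred_eq, droObjective_empirical]
      exact hpq'.trans (hqmax hq')
    -- If (MM) is feasible, the matrix of a joint maximizer is optimal. Otherwise the dual value is
    -- `⊥` on all of `Omega`, and `Ahat`, which lies there as `ε₂ ≥ 0`, is as good as any other
    -- matrix.
    · by_cases hne : (minimaxFeasible y Ahat Ξ ε₁ ε₂).Nonempty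
      · obtain ⟨q, hq, hqmax⟩ := hmax x hx hne
        refine ⟨q.1, hq.2.2, fun A hA => ?_⟩
        rw [mem_ofPred_eq, hval x hx, hval x hx]
        refine iSup₂_le fun ξ hξ => ?_
        have hle : minimaxObjective h y x (A, ξ) ≤ minimaxObjective h y x q :=
          hqmax ⟨hξ.1, hξ.2, hA⟩
        exact (EReal.coe_le_coe_iff.2 hle).trans (le_iSup₂
          (f := fun ξ (_ : ξ ∈ {ξ | ξ ∈ noiseTuples N Ξ ∧
            (1 / (N : ℝ)) * ∑ i, ‖ξ i - VARDRSO.residual y q.1 i‖ ^ 2 ≤ ε₁}) =>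
            (minimaxObjective h y x (q.1, ξ) : EReal)) q.2 ⟨hq.1, hq.2.1⟩)
      · refine ⟨Ahat, fun j => by simpa using hε₂ j, fun A hA => ?_⟩
        rw [mem_ofPred_eq, hval x hx]
        exact iSup₂_le fun ξ hξ => (hne ⟨(A, ξ), hξ.1, hξ.2, hA⟩).elim
    · intro A _ u _
      obtain ⟨v, hv⟩ := hΞne
      exact (isCompact_noiseTuples hΞ).exists_isMaxOn ⟨fun _ => v, fun _ => hv⟩
        (continuous_lagrangian y ε₁ (hcont x hx) A u).continuousOn
  · intro p _
    exact (convexOn_finsetSum hD Finset.univ fun i _ =>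
      hconvex (Matrix.toEuclideanLin p.1 (y (Fin.last N)) + p.2 i)).smul (by positivity)
  · intro x hx
    exact (concaveOn_minimaxObjective y (hconcave x hx)).subset (subset_univ _)
      (convex_minimaxFeasible y Ahat hΞconv ε₁ ε₂)
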